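/- For integers $0\le k\le n$ let $$\binom{n}{k}_q=\prod_{i=0}^{k-1}\frac{1-q^{n-i}}{1-q^{i+1}}$$ be the $q$-binomial coefficient, which is a polynomial in $q$ with integer coefficients, and for a polynomial $P(q)=\sum_j c_j q^j$ let $\|P\|_1=\sum_j |c_j|$. Then $$\sum_{k=0}^{n}\left\|\binom{n}{k}_q\cdot(1-q)^2\right\|_1=\mathcal O\left(2^n\,\frac{\log^2 n}{n^2}\right),$$ that is, there is a constant $C>0$ such that for every integer $n\ge 2$ the left-hand side is at most $C\,2^n(\log n)^2/n^2$. -/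

import Mathlib

open Polynomial

/-- The `q`-binomial coefficient `[n choose k]_q` as a polynomial in `q = X` with integer
coefficients, by the `q`-Pascal rule. The theorem `qBinom_eq_prod` below identifies it with
`∏_{i<k} (1 - q^(n-i)) / (1 - q^(i+1))` for `k ≤ n`. -/
noncomputable def qBinom : ℕ → ℕ → ℤ[X]
  | _, 0 => 1
  | 0, _ + 1 => 0
  | n + 1, k + 1 => qBinom n k + X ^ (k + 1) * qBinom n (k + 1)

theorem qBinom_mul_prod (n k : ℕ) :
    qBinom n k * ∏ i ∈ Finset.range k, (1 - X ^ (i + 1) : ℤ[X]) =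
      ∏ i ∈ Finset.range k, (1 - X ^ (n - i) : ℤ[X]) := by
  induction n generalizing k with
  | zero =>
    cases k with
    | zero => simp [qBinom]
    | succ k => simp [qBinom]
  | succ n ih =>
    cases k with
    | zero => simp [qBinom]
    | succ k =>
      have h1 := ih k
      have h2 := ih (k + 1)
      rw [Finset.prod_range_succ, Finset.prod_range_succ] at h2
      rw [Finset.prod_range_succ, Finset.prod_range_succ', qBinom]
      simp only [Nat.add_sub_add_right, Nat.sub_zero]
      rcases le_or_gt k n with hk | hk
      · have hX : (X : ℤ[X]) ^ (n + 1) = X ^ (k + 1) * X ^ (n - k) := by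
          rw [← pow_add]; congr 1; omega
        rw [hX]
        linear_combination (1 - X ^ (k + 1)) * h1 + X ^ (k + 1) * h2
      · have h0 : ∏ i ∈ Finset.range k, (1 - X ^ (n - i) : ℤ[X]) = 0 :=
          Finset.prod_eq_zero (Finset.mem_range.2 hk) (by simp)
        rw [h0] at h1 h2 ⊢
        linear_combination (1 - X ^ (k + 1)) * h1 + X ^ (k + 1) * h2

/-- The product formula, as an identity of rational functions in `q`. -/
theorem qBinom_eq_prod (n k : ℕ) :
    algebraMap ℤ[X] (RatFunc ℤ) (qBinom n k) =
      ∏ i ∈ Finset.range k, (1 - RatFunc.X ^ (n - i)) / (1 - RatFunc.X ^ (i + 1)) := by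
  have hinj : Function.Injective (algebraMap ℤ[X] (RatFunc ℤ)) :=
    IsFractionRing.injective ℤ[X] (RatFunc ℤ)
  have h := congrArg (algebraMap ℤ[X] (RatFunc ℤ)) (qBinom_mul_prod n k)
  simp only [map_mul, map_prod, map_sub, map_one, map_pow, RatFunc.algebraMap_X] at h
  rw [Finset.prod_div_distrib, eq_div_iff, h]
  refine Finset.prod_ne_zero_iff.2 fun i _ => ?_
  have hne : (1 - X ^ (i + 1) : ℤ[X]) ≠ 0 := by
    intro h0
    simpa using congrArg (fun p : ℤ[X] => p.coeff 0) h0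
  simpa using (map_ne_zero_iff _ hinj).2 hne

/-- The norm `‖p‖₁`: the sum of the absolute values of the coefficients of `p`. -/
noncomputable def coeffNorm (p : ℤ[X]) : ℝ :=
  ∑ i ∈ p.support, |(p.coeff i : ℝ)|

/-!
By the `q`-binomial theorem the polynomials `q ^ (k choose 2) * [n choose k]_q` are the coefficients
in `t` of `∏ i < n, (1 + t * q ^ i)`. So the sum of the norms over `k` is at most the `ℓ¹`-norm `N`
of `(1 - q) ^ 2 * ∏ i < n, (1 + t * q ^ i)` in `ℤ[q][t]`, which is a submultiplicative norm. Cutting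
the product into two halves and giving a factor `1 - q` to each, it is enough to prove
`N ((1 - q) * ∏ i < m, (1 + x * q ^ i)) = O (2 ^ m / m)` whenever `N x ≤ 1`
(`seminorm_one_sub_mul_prod_le`).

For this, group the factors into pairs at distance `d`, where
`(1 + y) * (1 + y * q ^ d) = (1 + y ^ 2 * q ^ d) + y * (1 + q ^ d)`.
A product of `r` such pairs is `E + (1 + q ^ d) * Q` with `N E ≤ 2 ^ r` and `N Q ≤ 4 ^ r / 2`
(`exists_prod_pairs_eq`); in terms of a random subset of the indices, `E` is the event that no pair
has exactly one of its elements selected. Multiplication by `1 - q ^ d` turns the main term into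
`(1 - q ^ (2 * d)) * Q`, so that, relative to the total mass, `1 - q ^ d` has been replaced by
`(1 - q ^ (2 * d)) / 2`, up to an error `2 * 2 ^ (-r)`. Doing this for
`d = 1, 2, 4, …, 2 ^ (L - 1)` on consecutive blocks of indices gains a factor of order `2 ^ (-L)`,
and blocks of total length at most `8 * 2 ^ L` are enough to keep the sum of the errors of the same
order (`seminorm_one_sub_pow_mul_prod_blockLength_le`). The resulting bound `O (2 ^ n / n ^ 2)` is
stronger than the one claimed.
-/

/-! ### The `ℓ¹` seminorm on polynomials -/

theorem Polynomial.sum_seminorm_add_le {R : Type*} [CommRing R] (N : RingSeminorm R) (p q : R[X]) :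
    ((p + q).sum fun _ a => N a) ≤ (p.sum fun _ a => N a) + q.sum fun _ a => N a := by
  have hN : ∀ _ : ℕ, N (0 : R) = 0 := fun _ => map_zero N
  rw [Polynomial.sum_eq_of_subset (fun _ a => N a) hN (Polynomial.support_add (p := p) (q := q)),
    Polynomial.sum_eq_of_subset (fun _ a => N a) hN (Finset.subset_union_left (s₂ := q.support)),
    Polynomial.sum_eq_of_subset (fun _ a => N a) hN (Finset.subset_union_right (s₁ := p.support)),
    ← Finset.sum_add_distrib]
  exact Finset.sum_le_sum fun i _ => by
    rw [Polynomial.coeff_add]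
    exact map_add_le_add N _ _

/-- The `ℓ¹` seminorm on `R[X]` attached to a ring seminorm on `R`: the sum of the seminorms of the
coefficients. -/
noncomputable def RingSeminorm.polynomialSum {R : Type*} [CommRing R] (N : RingSeminorm R) :
    RingSeminorm R[X] where
  toFun p := p.sum fun _ a => N a
  map_zero' := Polynomial.sum_zero_index _
  neg' p := by simp [Polynomial.sum_def, map_neg_eq_map]
  add_le' := Polynomial.sum_seminorm_add_le N
  mul_le' p q := by
    have hsub := Finset.le_sum_of_subadditive (ι := ℕ)
      (fun p : R[X] => p.sum fun _ a => N a)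
      (Polynomial.sum_zero_index _).le (Polynomial.sum_seminorm_add_le N)
    rw [Polynomial.mul_eq_sum_sum, Polynomial.sum_def p, Finset.sum_mul]
    refine (hsub _ _).trans (Finset.sum_le_sum fun i _ => ?_)
    rw [Polynomial.sum_def q, Polynomial.sum_def q, Finset.mul_sum]
    refine (hsub _ _).trans (Finset.sum_le_sum fun j _ => ?_)
    rw [Polynomial.sum_monomial_index _ _ (map_zero N)]
    exact map_mul_le_mul N _ _

/-! ### Products of pairs and smoothing -/

section Smoothing

variable {R : Type*} [CommRing R] (N : RingSeminorm R)

theorem RingSeminorm.pow_le_one {q : R} (h1 : N 1 ≤ 1) (hq : N q ≤ 1) (n : ℕ) : N (q ^ n) ≤ 1 := by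
  induction n with
  | zero => simpa using h1
  | succ n ih =>
    rw [pow_succ]
    exact (map_mul_le_mul N _ _).trans (mul_le_one₀ ih (apply_nonneg N _) hq)

theorem RingSeminorm.mul_le_of_le {x y : R} {a b : ℝ} (hx : N x ≤ a) (hy : N y ≤ b) :
    N (x * y) ≤ a * b :=
  (map_mul_le_mul N x y).trans
    (mul_le_mul hx hy (apply_nonneg N _) ((apply_nonneg N _).trans hx))

theorem RingSeminorm.one_add_le_two {y : R} (h1 : N 1 ≤ 1) (hy : N y ≤ 1) : N (1 + y) ≤ 2 := by
  linarith [map_add_le_add N 1 y]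

theorem RingSeminorm.one_sub_le_two {y : R} (h1 : N 1 ≤ 1) (hy : N y ≤ 1) : N (1 - y) ≤ 2 := by
  linarith [map_sub_le_add N 1 y]

theorem seminorm_prod_one_add_le {q x : R} (h1 : N 1 ≤ 1) (hq : N q ≤ 1) (hx : N x ≤ 1) (n : ℕ) :
    N (∏ i ∈ Finset.range n, (1 + x * q ^ i)) ≤ 2 ^ n := by
  induction n with
  | zero => simpa using h1
  | succ n ih =>
    rw [Finset.prod_range_succ, pow_succ]
    refine N.mul_le_of_le ih (N.one_add_le_two h1 ?_)
    simpa using N.mul_le_of_le hx (N.pow_le_one h1 hq n)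

/-- A product of `r` pairs `(1 + y) * (1 + y * z)` is a multiple of `1 + z` of half the total mass,
up to a term of mass `2 ^ r`. -/
theorem exists_prod_pairs_eq {ι : Type*} {z : R} {y : ι → R} (h1 : N 1 ≤ 1) (hz : N z ≤ 1)
    (hy : ∀ i, N (y i) ≤ 1) (s : Finset ι) :
    ∃ E Q : R, ∏ i ∈ s, ((1 + y i) * (1 + y i * z)) = E + (1 + z) * Q ∧
      N E ≤ 2 ^ s.card ∧ N Q ≤ 4 ^ s.card / 2 := by
  classical
  have hyz : ∀ i, N (y i * z) ≤ 1 := fun i => by simpa using N.mul_le_of_le (hy i) hz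
  have hF : ∀ s : Finset ι, N (∏ i ∈ s, ((1 + y i) * (1 + y i * z))) ≤ 4 ^ s.card := by
    intro s
    induction s using Finset.induction_on with
    | empty => simpa using h1
    | insert a s ha ih =>
      rw [Finset.prod_insert ha, Finset.card_insert_of_notMem ha, pow_succ']
      refine N.mul_le_of_le ?_ ih
      have := N.mul_le_of_le (N.one_add_le_two h1 (hy a)) (N.one_add_le_two h1 (hyz a))
      linarith
  induction s using Finset.induction_on with
  | empty => exact ⟨1, 0, by simp, by simpa using h1, by simp⟩
  | insert a s ha ih =>
    obtain ⟨E, Q, hEQ, hE, hQ⟩ := ih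
    have hA : N (1 + y a * (y a * z)) ≤ 2 :=
      N.one_add_le_two h1 (by simpa using N.mul_le_of_le (hy a) (hyz a))
    refine ⟨(1 + y a * (y a * z)) * E,
      (1 + y a * (y a * z)) * Q + y a * ∏ i ∈ s, ((1 + y i) * (1 + y i * z)), ?_, ?_, ?_⟩
    · rw [Finset.prod_insert ha]
      linear_combination (1 + y a * (y a * z)) * hEQ
    · rw [Finset.card_insert_of_notMem ha, pow_succ']
      exact N.mul_le_of_le hA hE
    · rw [Finset.card_insert_of_notMem ha, pow_succ']
      have h2 := N.mul_le_of_le hA hQ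
      have h3 := N.mul_le_of_le (hy a) (hF s)
      have h4 := map_add_le_add N ((1 + y a * (y a * z)) * Q)
        (y a * ∏ i ∈ s, ((1 + y i) * (1 + y i * z)))
      linarith

theorem prod_range_add_one_add_mul_pow (q x : R) (a b : ℕ) :
    ∏ i ∈ Finset.range (a + b), (1 + x * q ^ i) =
      (∏ i ∈ Finset.range a, (1 + x * q ^ i)) *
        ∏ i ∈ Finset.range b, (1 + x * q ^ a * q ^ i) := by
  rw [Finset.prod_range_add]
  simp only [pow_add, mul_assoc]

/-- The indices below `2 * d * c` fall into `c * d` disjoint pairs at distance `d`. -/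
theorem prod_range_eq_prod_pairs (q x : R) (c d : ℕ) :
    ∏ i ∈ Finset.range (2 * d * c), (1 + x * q ^ i) =
      ∏ p ∈ Finset.range c ×ˢ Finset.range d,
        ((1 + x * q ^ (2 * d * p.1 + p.2)) * (1 + x * q ^ (2 * d * p.1 + p.2) * q ^ d)) := by
  rw [Finset.prod_product]
  induction c with
  | zero => simp
  | succ c ih =>
    rw [Finset.prod_range_succ, ← ih, show 2 * d * (c + 1) = 2 * d * c + (d + d) by ring,
      Finset.prod_range_add, Finset.prod_range_add, ← Finset.prod_mul_distrib]
    congr 1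
    refine Finset.prod_congr rfl fun i _ => ?_
    ring

/-- The length, in units of `2 ^ l`, of an interval of indices that suffices to smooth `j` times,
at the distances `2 ^ l, …, 2 ^ (l + j - 1)`. -/
def blockLength : ℕ → ℕ
  | 0 => 0
  | j + 1 => 4 * (j + 1) + 2 * blockLength j

theorem blockLength_le (j : ℕ) : blockLength j ≤ 8 * 2 ^ j := by
  have h : blockLength j + 4 * j + 8 = 8 * 2 ^ j := by
    induction j with
    | zero => rfl
    | succ j ih => rw [blockLength, pow_succ]; omega
  omega

/-- Replacing `1 - z` by `1 - z ^ 2` at the cost of a factor `1 / 2` and an error term. -/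
theorem seminorm_one_sub_mul_le_of_eq {z F G E Q : R} {r g : ℕ} {b : ℝ} (h1 : N 1 ≤ 1)
    (hz : N z ≤ 1) (hF : F = E + (1 + z) * Q) (hE : N E ≤ 2 ^ r) (hQ : N Q ≤ 4 ^ r / 2)
    (hG : N G ≤ 2 ^ g) (hG' : N ((1 - z ^ 2) * G) ≤ 2 ^ g * b) :
    N ((1 - z) * (F * G)) ≤ 4 ^ r * 2 ^ g * (2 * (1 / 2) ^ r + b / 2) := by
  have h2 := N.mul_le_of_le (N.mul_le_of_le (N.one_sub_le_two h1 hz) hE) hG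
  have h3 := N.mul_le_of_le hQ hG'
  have h4 := map_add_le_add N ((1 - z) * E * G) (Q * ((1 - z ^ 2) * G))
  have h5 : (1 - z) * (F * G) = (1 - z) * E * G + Q * ((1 - z ^ 2) * G) := by rw [hF]; ring
  have h6 : (4 : ℝ) ^ r * (1 / 2) ^ r = 2 ^ r := by rw [← mul_pow]; norm_num
  rw [h5]
  linear_combination h4 + h2 + h3 - 2 * 2 ^ g * h6

/-- `j` smoothing steps, starting at distance `2 ^ l`. The negative term makes the induction on `j`
close. -/
theorem seminorm_one_sub_pow_mul_prod_blockLength_le {q : R} (h1 : N 1 ≤ 1) (hq : N q ≤ 1)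
    (j : ℕ) : ∀ (l : ℕ) {x : R}, N x ≤ 1 →
      N ((1 - q ^ 2 ^ l) * ∏ i ∈ Finset.range (2 ^ l * blockLength j), (1 + x * q ^ i)) ≤
        2 ^ (2 ^ l * blockLength j) * (4 * (1 / 2) ^ j - 2 * (1 / 4) ^ j) := by
  induction j with
  | zero =>
    intro l x _
    have := N.one_sub_le_two h1 (N.pow_le_one h1 hq (2 ^ l))
    simp only [blockLength, mul_zero, Finset.range_zero, Finset.prod_empty, mul_one, pow_zero]
    linarith
  | succ j ih =>
    intro l x hx
    -- The first block has `2 ^ l * (2 * (j + 1)) ≥ 2 * (j + 1)` pairs at distance `2 ^ l`.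
    have hlen : 2 ^ l * blockLength (j + 1) =
        2 * 2 ^ l * (2 * (j + 1)) + 2 ^ (l + 1) * blockLength j := by
      rw [blockLength]; ring
    have hmul : ∀ m, N (x * q ^ m) ≤ 1 := fun m => by
      simpa using N.mul_le_of_le hx (N.pow_le_one h1 hq m)
    have hz := N.pow_le_one h1 hq (2 ^ l)
    obtain ⟨E, Q, hF, hE, hQ⟩ := exists_prod_pairs_eq N h1 hz
      (fun p : ℕ × ℕ => hmul (2 * 2 ^ l * p.1 + p.2))
      (Finset.range (2 * (j + 1)) ×ˢ Finset.range (2 ^ l))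
    rw [← prod_range_eq_prod_pairs] at hF
    rw [Finset.card_product, Finset.card_range, Finset.card_range] at hE hQ
    have hG := seminorm_prod_one_add_le N h1 hq (hmul (2 * 2 ^ l * (2 * (j + 1))))
      (2 ^ (l + 1) * blockLength j)
    have hG' := ih (l + 1) (hmul (2 * 2 ^ l * (2 * (j + 1))))
    rw [pow_succ 2 l, pow_mul q (2 ^ l) 2, ← pow_succ 2 l] at hG'
    have key := seminorm_one_sub_mul_le_of_eq N h1 hz hF hE hQ hG hG'
    rw [hlen, prod_range_add_one_add_mul_pow]
    refine key.trans ?_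
    have h4 : (4 : ℝ) ^ (2 * (j + 1) * 2 ^ l) = 2 ^ (2 * 2 ^ l * (2 * (j + 1))) := by
      rw [show (4 : ℝ) = 2 ^ 2 by norm_num, ← pow_mul]
      congr 1
      ring
    rw [h4, ← pow_add]
    refine mul_le_mul_of_nonneg_left ?_ (by positivity)
    have h2 : ((1 : ℝ) / 2) ^ (2 * (j + 1) * 2 ^ l) ≤ (1 / 2) ^ (2 * (j + 1)) :=
      pow_le_pow_of_le_one (by norm_num) (by norm_num)
        (Nat.le_mul_of_pos_right _ (by positivity))
    rw [pow_mul (1 / 2 : ℝ) 2 (j + 1), show ((1 : ℝ) / 2) ^ 2 = 1 / 4 by norm_num, pow_succ] at h2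
    rw [pow_succ, pow_succ]
    linarith

theorem seminorm_one_sub_mul_prod_le {q x : R} (h1 : N 1 ≤ 1) (hq : N q ≤ 1) (hx : N x ≤ 1)
    {m : ℕ} (hm : 0 < m) :
    N ((1 - q) * ∏ i ∈ Finset.range m, (1 + x * q ^ i)) ≤ 2 ^ m * (64 / m) := by
  obtain ⟨L, hL, hL'⟩ : ∃ L, blockLength L ≤ m ∧ m ≤ 16 * 2 ^ L := by
    have hlog := Nat.lt_pow_succ_log_self (b := 2) (by norm_num) m
    have hlog' := Nat.pow_log_le_self 2 hm.ne'
    rcases le_or_gt (Nat.log 2 m) 3 with h | h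
    · refine ⟨0, by simp [blockLength], ?_⟩
      have := Nat.pow_le_pow_right (n := 2) (by norm_num) (Nat.succ_le_succ h)
      norm_num at this ⊢
      omega
    · obtain ⟨L, hL⟩ := Nat.exists_eq_add_of_le h.le
      rw [hL, Nat.succ_eq_add_one, pow_succ, pow_add] at hlog
      rw [hL, pow_add] at hlog'
      have := blockLength_le L
      exact ⟨L, by omega, by omega⟩
  obtain ⟨r, rfl⟩ := Nat.exists_eq_add_of_le hL
  have hrest := seminorm_prod_one_add_le N h1 hq (x := x * q ^ blockLength L)
    (by simpa using N.mul_le_of_le hx (N.pow_le_one h1 hq _)) r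
  have hmain := seminorm_one_sub_pow_mul_prod_blockLength_le N h1 hq L 0 hx
  rw [pow_zero, pow_one, one_mul] at hmain
  rw [prod_range_add_one_add_mul_pow, ← mul_assoc]
  refine (N.mul_le_of_le hmain hrest).trans ?_
  have h2 : 4 * (1 / 2 : ℝ) ^ L ≤ 64 / ((blockLength L + r : ℕ) : ℝ) := by
    have hL'' : ((blockLength L + r : ℕ) : ℝ) ≤ 16 * 2 ^ L := by exact_mod_cast hL'
    rw [le_div_iff₀ (by exact_mod_cast hm)]
    calc 4 * (1 / 2 : ℝ) ^ L * ((blockLength L + r : ℕ) : ℝ)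
        ≤ 4 * (1 / 2 : ℝ) ^ L * (16 * 2 ^ L) := by gcongr
      _ = 64 * ((1 / 2 : ℝ) * 2) ^ L := by rw [mul_pow]; ring
      _ = 64 := by norm_num
  rw [mul_right_comm, ← pow_add]
  refine mul_le_mul_of_nonneg_left (le_trans ?_ h2) (by positivity)
  have : (0 : ℝ) ≤ (1 / 4) ^ L := by positivity
  linarith

theorem seminorm_one_sub_sq_mul_prod_le {q x : R} (h1 : N 1 ≤ 1) (hq : N q ≤ 1) (hx : N x ≤ 1)
    {n : ℕ} (hn : 2 ≤ n) :
    N ((1 - q) ^ 2 * ∏ i ∈ Finset.range n, (1 + x * q ^ i)) ≤ 2 ^ n * (192 / n) ^ 2 := by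
  obtain ⟨a, b, rfl, ha, hb⟩ : ∃ a b, n = a + b ∧ n ≤ 3 * a ∧ n ≤ 3 * b :=
    ⟨n / 2, n - n / 2, by omega, by omega, by omega⟩
  have hxq : N (x * q ^ a) ≤ 1 := by simpa using N.mul_le_of_le hx (N.pow_le_one h1 hq a)
  have hA := seminorm_one_sub_mul_prod_le N h1 hq hx (m := a) (by omega)
  have hB := seminorm_one_sub_mul_prod_le N h1 hq hxq (m := b) (by omega)
  have hn0 : (0 : ℝ) < ((a + b : ℕ) : ℝ) := by exact_mod_cast (by omega : 0 < a + b)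
  have hbound : ∀ m : ℕ, a + b ≤ 3 * m → 64 / (m : ℝ) ≤ 192 / ((a + b : ℕ) : ℝ) := by
    intro m hm
    have hm' : ((a + b : ℕ) : ℝ) ≤ 3 * m := by exact_mod_cast hm
    rw [div_le_div_iff₀ (by linarith) hn0]
    linarith
  rw [prod_range_add_one_add_mul_pow, sq, mul_mul_mul_comm]
  refine (N.mul_le_of_le hA hB).trans ?_
  rw [mul_mul_mul_comm, ← pow_add, sq (192 / _)]
  exact mul_le_mul_of_nonneg_left
    (mul_le_mul (hbound a ha) (hbound b hb) (by positivity) (by positivity)) (by positivity)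

end Smoothing

/-! ### The `q`-binomial theorem and the final estimate -/

theorem qBinom_eq_zero_of_lt {n k : ℕ} (h : n < k) : qBinom n k = 0 := by
  induction n generalizing k with
  | zero => cases k with
    | zero => omega
    | succ k => simp [qBinom]
  | succ n ih => cases k with
    | zero => omega
    | succ k => rw [qBinom, ih (by omega), ih (by omega)]; simp

/-- The `q`-binomial theorem. -/
theorem prod_one_add_eq_sum_qBinom {R : Type*} [CommRing R] [Algebra ℤ[X] R] (n : ℕ) (t : R) :
    ∏ i ∈ Finset.range n, (1 + t * algebraMap ℤ[X] R X ^ i) =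
      ∑ k ∈ Finset.range (n + 1), algebraMap ℤ[X] R (X ^ k.choose 2 * qBinom n k) * t ^ k := by
  induction n generalizing t with
  | zero => simp [qBinom]
  | succ n ih =>
    have h : ∏ i ∈ Finset.range n, (1 + t * algebraMap ℤ[X] R X ^ (i + 1)) =
        ∑ k ∈ Finset.range (n + 1), algebraMap ℤ[X] R (X ^ k.choose 2 * qBinom n k) *
          (t * algebraMap ℤ[X] R X) ^ k := by
      rw [← ih]
      refine Finset.prod_congr rfl fun i _ => ?_
      ring
    rw [Finset.prod_range_succ', h, Finset.sum_range_succ' _ (n + 1), pow_zero, mul_one, mul_add,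
      mul_one, Finset.sum_mul]
    -- Extend the sum for `n` by its vanishing term of index `n + 1`, to match it with the shifted
    -- sum for `n + 1`.
    have h0 : ∑ k ∈ Finset.range (n + 1), algebraMap ℤ[X] R (X ^ k.choose 2 * qBinom n k) *
          (t * algebraMap ℤ[X] R X) ^ k =
        ∑ k ∈ Finset.range (n + 1), algebraMap ℤ[X] R (X ^ (k + 1).choose 2 * qBinom n (k + 1)) *
          (t * algebraMap ℤ[X] R X) ^ (k + 1) + 1 := by
      have := Finset.sum_range_succ' (fun k => algebraMap ℤ[X] R (X ^ k.choose 2 * qBinom n k) *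
          (t * algebraMap ℤ[X] R X) ^ k) (n + 1)
      rw [Finset.sum_range_succ, qBinom_eq_zero_of_lt (Nat.lt_succ_self n)] at this
      simpa [qBinom] using this
    nth_rewrite 1 [h0]
    rw [add_right_comm, ← Finset.sum_add_distrib]
    congr 1
    · refine Finset.sum_congr rfl fun k _ => ?_
      rw [qBinom, Nat.choose_succ_succ' k 1, Nat.choose_one_right]
      simp only [map_mul, map_add, map_pow]
      ring
    · simp [qBinom]

theorem coeffNorm_eq_polynomialSum (p : ℤ[X]) :
    coeffNorm p = (normRingSeminorm ℤ).polynomialSum p := by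
  change _ = ∑ i ∈ p.support, ‖p.coeff i‖
  simp [coeffNorm, Int.norm_eq_abs]

theorem coeffNorm_X_pow_mul (m : ℕ) (p : ℤ[X]) : coeffNorm (X ^ m * p) = coeffNorm p := by
  refine (Finset.sum_nbij (· + m) ?_ (add_left_injective m).injOn ?_ ?_).symm
  · intro i hi
    simpa [Polynomial.coeff_X_pow_mul] using hi
  · intro i hi
    rw [Finset.mem_coe, Polynomial.mem_support_iff, Polynomial.coeff_X_pow_mul'] at hi
    obtain ⟨hmi, hi⟩ := ite_ne_right_iff.1 hi
    exact ⟨i - m, by simpa using hi, Nat.sub_add_cancel hmi⟩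
  · intro i _
    rw [Polynomial.coeff_X_pow_mul]

theorem theorem4p3 :
    ∃ C : ℝ, 0 < C ∧ ∀ n : ℕ, 2 ≤ n →
      ∑ k ∈ Finset.range (n + 1), coeffNorm (qBinom n k * (1 - X) ^ 2) ≤
        C * ((2 : ℝ) ^ n * (Real.log (n : ℝ) ^ 2 / (n : ℝ) ^ 2)) := by
  refine ⟨(2 * 192) ^ 2, by norm_num, fun n hn => ?_⟩
  set N₁ : RingSeminorm ℤ[X] := (normRingSeminorm ℤ).polynomialSum with hN₁
  set N₂ : RingSeminorm ℤ[X][X] := N₁.polynomialSum with hN₂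
  have hcoeff : ∀ p : ℤ[X][X], N₂ p = p.sum fun _ a => N₁ a := fun _ => rfl
  have hcoeff₁ : ∀ p : ℤ[X], N₁ p = p.sum fun _ a => ‖a‖ := fun _ => rfl
  have hone : N₁ 1 ≤ 1 := by
    rw [hcoeff₁, ← Polynomial.C_1, Polynomial.sum_C_index] <;> simp
  have h1 : N₂ 1 ≤ 1 := by
    rw [hcoeff, ← Polynomial.C_1, Polynomial.sum_C_index] <;> simp [hone]
  have hX : N₂ X ≤ 1 := by
    rw [hcoeff, Polynomial.sum_X_index] <;> simp [hone]
  have hq : N₂ (algebraMap ℤ[X] ℤ[X][X] X) ≤ 1 := by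
    rw [hcoeff, ← Polynomial.C_eq_algebraMap, Polynomial.sum_C_index, hcoeff₁,
      Polynomial.sum_X_index] <;> simp
  have hmain := seminorm_one_sub_sq_mul_prod_le N₂ h1 hq hX hn
  have hsum : ∑ k ∈ Finset.range (n + 1), coeffNorm (qBinom n k * (1 - X) ^ 2) ≤
      N₂ ((1 - algebraMap ℤ[X] ℤ[X][X] X) ^ 2 *
        ∏ i ∈ Finset.range n, (1 + X * algebraMap ℤ[X] ℤ[X][X] X ^ i)) := by
    set P : ℤ[X][X] := (1 - algebraMap ℤ[X] ℤ[X][X] X) ^ 2 *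
        ∏ i ∈ Finset.range n, (1 + X * algebraMap ℤ[X] ℤ[X][X] X ^ i) with hP
    have hPc : ∀ k ∈ Finset.range (n + 1),
        P.coeff k = X ^ k.choose 2 * (qBinom n k * (1 - X) ^ 2) := by
      intro k hk
      have : (1 - algebraMap ℤ[X] ℤ[X][X] X) ^ 2 = Polynomial.C ((1 - X) ^ 2 : ℤ[X]) := by
        simp only [← Polynomial.C_eq_algebraMap, map_pow, map_sub, map_one]
      rw [hP, prod_one_add_eq_sum_qBinom, this, Polynomial.coeff_C_mul,
        Polynomial.finsetSum_coeff]
      simp only [← Polynomial.C_eq_algebraMap, Polynomial.coeff_C_mul_X_pow]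
      rw [Finset.sum_ite_eq, if_pos hk]
      ring
    rw [hcoeff, Polynomial.sum_eq_of_subset (s := P.support ∪ Finset.range (n + 1)) _
      (fun _ => map_zero N₁) Finset.subset_union_left]
    refine le_trans (le_of_eq ?_) (Finset.sum_le_sum_of_subset_of_nonneg
      Finset.subset_union_right fun _ _ _ => apply_nonneg N₁ _)
    refine Finset.sum_congr rfl fun k hk => ?_
    rw [hPc k hk, hN₁, ← coeffNorm_eq_polynomialSum, coeffNorm_X_pow_mul]
  refine (hsum.trans hmain).trans ?_
  -- For `n ≥ 2` the factor `(log n) ^ 2` is at least `1 / 4`.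
  have hlog : 1 / 2 ≤ Real.log n := by
    have h2 : Real.log 2 ≤ Real.log n := Real.log_le_log (by norm_num) (by exact_mod_cast hn)
    linarith [Real.log_two_gt_d9]
  have hsq : 1 ≤ (2 * Real.log n) ^ 2 := one_le_pow₀ (by linarith)
  calc (2 : ℝ) ^ n * (192 / n) ^ 2 = 2 ^ n * (192 / n) ^ 2 * 1 := by ring
    _ ≤ 2 ^ n * (192 / n) ^ 2 * (2 * Real.log n) ^ 2 := by gcongr
    _ = (2 * 192) ^ 2 * (2 ^ n * (Real.log n ^ 2 / n ^ 2)) := by ring
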